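/- Let $g\ge 1$ and let $H_{2g+1}=\langle \mathbf y_1,\dots,\mathbf y_{2g+1}\mid \mathbf y_1^2,\dots,\mathbf y_{2g+1}^2\rangle=T_{2g+1}/I_{2g+1}$, where $T_{2g+1}$ is the free group on $\mathbf y_1,\dots,\mathbf y_{2g+1}$ and $I_{2g+1}$ is the normal closure of $\{\mathbf y_i^2\}$. Let $F_{2g}$ be the kernel of $H_{2g+1}\to\mathbb Z/2$, $\mathbf y_i\mapsto 1$; it is free on $\mathbf x_i=\mathbf y_i\mathbf y_{i+1}$ ($1\le i\le 2g$). Put $\Delta=\mathbf y_1\mathbf y_2\cdots\mathbf y_{2g+1}$, so that $\Delta^2\in F_{2g}$, and $\mathcal M_{g,1}=\{\phi\in\mathrm{Aut}(F_{2g})\mid\phi(\Delta^2)=\Delta^2\}$. Let $N\triangleleft F_{2g}$ be a normal subgroup with $\phi(N)=N$ for all $\phi\in\mathcal M_{g,1}$. Then $N$ is also normal in $H_{2g+1}$; put $G=F_{2g}/N\subset G^+=H_{2g+1}/N$ and let $y_i\in G^+$ be the image of $\mathbf y_i$. Let $L_N=\bigoplus_{i=1}^{2g}\mathbb Z[G]e_i$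 with its Fox derivation $\mathfrak d_N:F_{2g}\to L_N$, the unique map with $\mathfrak d_N(ab)=\mathfrak d_N(a)+\bar a\,\mathfrak d_N(b)$ and $\mathfrak d_N(\mathbf x_i)=e_i$, where $\bar a$ is the image of $a$ in $G$. Let $\mathfrak d_{\tilde N}:T_{2g+1}\to L_{\tilde N}=\bigoplus_{i=1}^{2g+1}\mathbb Z[G^+]e_i$ be the analogous Fox derivation with $\mathfrak d_{\tilde N}(\mathbf y_i)=e_i$, defined through $T_{2g+1}\to G^+$. The set $\mathfrak d_{\tilde N}(I_{2g+1})$ is a $\mathbb Z[G^+]$-submodule. Let $L_N^+=L_{\tilde N}/\mathfrak d_{\tilde N}(I_{2g+1})$, let $\mathfrak d_N^+:H_{2g+1}\to L_N^+$ be the map induced by $\mathfrak d_{\tilde N}$, and let $\hat\iota:L_N\to L_N^+$ be the $\mathbb Z[G]$-homomorphism with $\hat\iota(\mathfrak d_N(a))=\mathfrak d_N^+(a)$ for $a\in F_{2g}$. For $1\le i\le g$ put $$u_{2i}=y_1y_2\cdots y_{2i-1}\,\mathfrak d_N^+(\mathbf y_{2i}\mathbf y_{2i+1}\cdots\mathbf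 y_{2g+1}),\qquad u_{2i-1}=-\,y_{2g+1}y_{2g}\cdots y_{2i+1}\,\mathfrak d_N^+(\mathbf y_{2i}\mathbf y_{2i-1}\cdots\mathbf y_1),$$ and $w_0=\mathfrak d_N^+(\Delta)$. **Theorem.** If $G$ is finite, then $\{u_1,\dots,u_{2g},w_0\}$ is a free $\mathbb Z[G]$-basis of $L_N^+$. Moreover $\hat\iota$ is injective, and, when $L_N$ is identified with its image $\hat\iota(L_N)\subset L_N^+$, $\{y_1u_1,\dots,y_1u_{2g}\}$ is a free $\mathbb Z[G]$-basis of $L_N$. -/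

import Mathlib

noncomputable section

namespace Magnus

/-! ### Fox derivations on a free group -/

section Fox

variable {ι F Q : Type*} [Group F] [Group Q]

/-- For a quotient map `ρ : F → Q` of a free group `F` with free basis indexed by `ι`, the Magnus
module is the free left `ℤ[Q]`-module `⨁ᵢ ℤ[Q] eᵢ`, where `eᵢ = Finsupp.single i 1`. -/
abbrev FreeMod (ι Q : Type*) [Group Q] : Type _ := ι →₀ MonoidAlgebra ℤ Q

/-- The bijection `v ↦ q v + m` of the Magnus module. -/
def affine (q : Q) (m : FreeMod ι Q) : Equiv.Perm (FreeMod ι Q) :=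
  (MulAction.toPerm (Units.map (MonoidAlgebra.of ℤ Q) (toUnits q))).trans (Equiv.addRight m)

theorem affine_apply (q : Q) (m v : FreeMod ι Q) :
    affine q m v = MonoidAlgebra.of ℤ Q q • v + m := rfl

/-- The homomorphism sending the basis element `bᵢ` to the affine map `v ↦ ρ(bᵢ) v + eᵢ`. -/
def affineHom (b : FreeGroupBasis ι F) (ρ : F →* Q) : F →* Equiv.Perm (FreeMod ι Q) :=
  b.lift fun i => affine (ρ (b i)) (Finsupp.single i 1)

/-- The Fox derivation `F → ⨁ᵢ ℤ[Q] eᵢ`: the unique crossed homomorphism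
(see `fox_mul`, `fox_unique`) with `bᵢ ↦ eᵢ` (see `fox_basis`). -/
def fox (b : FreeGroupBasis ι F) (ρ : F →* Q) (a : F) : FreeMod ι Q :=
  affineHom b ρ a 0

theorem affineHom_basis (b : FreeGroupBasis ι F) (ρ : F →* Q) (i : ι) :
    affineHom b ρ (b i) = affine (ρ (b i)) (Finsupp.single i 1) := by
  simp [affineHom, FreeGroupBasis.lift, FreeGroupBasis.repr_apply_coe]

theorem basis_closure (b : FreeGroupBasis ι F) : Subgroup.closure (Set.range b) = ⊤ := by
  rw [eq_top_iff]
  intro a _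
  have h : ∀ w : FreeGroup ι, b.repr.symm w ∈ Subgroup.closure (Set.range b) := by
    intro w
    induction w using FreeGroup.induction_on with
    | C1 => rw [map_one]; exact one_mem _
    | of i => exact Subgroup.subset_closure ⟨i, rfl⟩
    | inv_of i hi => rw [map_inv]; exact inv_mem hi
    | mul x y hx hy => rw [map_mul]; exact mul_mem hx hy
  simpa using h (b.repr a)

theorem affineHom_apply (b : FreeGroupBasis ι F) (ρ : F →* Q) (a : F) :
    affineHom b ρ a = affine (ρ a) (fox b ρ a) := by
  have ha : a ∈ Subgroup.closure (Set.range b) := by rw [basis_closure]; trivial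
  have key : ∀ v, affineHom b ρ a v = MonoidAlgebra.of ℤ Q (ρ a) • v + affineHom b ρ a 0 := by
    induction ha using Subgroup.closure_induction with
    | mem x hx =>
      obtain ⟨i, rfl⟩ := hx
      intro v
      simp [affineHom_basis, affine_apply]
    | one => intro v; simp [← MonoidAlgebra.one_def]
    | mul x y _ _ hx hy =>
      intro v
      simp only [map_mul, Equiv.Perm.mul_apply]
      rw [hx, hy, hx (affineHom b ρ y 0), smul_add, mul_smul, add_assoc]
    | inv x _ hx =>
      intro v
      have h1 : ∀ w, affineHom b ρ x⁻¹ (affineHom b ρ x w) = w := by intro w; simp [map_inv]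
      have h2 : ∀ w, affineHom b ρ x (affineHom b ρ x⁻¹ w) = w := by intro w; simp [map_inv]
      apply (affineHom b ρ x).injective
      rw [h2, hx, smul_add, ← mul_smul, ← map_mul, ← map_mul, mul_inv_cancel, map_one, map_one,
        one_smul, add_assoc, ← hx, h2, add_zero]
  ext1 v
  rw [key, affine_apply]
  rfl

theorem fox_basis (b : FreeGroupBasis ι F) (ρ : F →* Q) (i : ι) :
    fox b ρ (b i) = Finsupp.single i 1 := by
  simp [fox, affineHom_basis, affine_apply]

theorem fox_mul (b : FreeGroupBasis ι F) (ρ : F →* Q) (x y : F) :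
    fox b ρ (x * y) = fox b ρ x + MonoidAlgebra.of ℤ Q (ρ x) • fox b ρ y := by
  have h : fox b ρ (x * y) = affineHom b ρ x (fox b ρ y) := by simp [fox]
  rw [h, affineHom_apply, affine_apply, add_comm]

theorem fox_one (b : FreeGroupBasis ι F) (ρ : F →* Q) : fox b ρ 1 = 0 := by
  simp [fox]

theorem fox_inv (b : FreeGroupBasis ι F) (ρ : F →* Q) (x : F) :
    fox b ρ x⁻¹ = -(MonoidAlgebra.of ℤ Q (ρ x⁻¹) • fox b ρ x) := by
  have h := fox_mul b ρ x⁻¹ x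
  rw [inv_mul_cancel, fox_one] at h
  exact eq_neg_of_add_eq_zero_left h.symm

/-- Two crossed homomorphisms to a `ℤ[Q]`-module that agree on the basis are equal. -/
theorem crossed_unique {M : Type*} [AddCommGroup M] [Module (MonoidAlgebra ℤ Q) M]
    (b : FreeGroupBasis ι F) (ρ : F →* Q) (d d' : F → M)
    (hd : ∀ x y, d (x * y) = d x + MonoidAlgebra.of ℤ Q (ρ x) • d y)
    (hd' : ∀ x y, d' (x * y) = d' x + MonoidAlgebra.of ℤ Q (ρ x) • d' y)
    (h : ∀ i, d (b i) = d' (b i)) : d = d' := by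
  have one : ∀ e : F → M, (∀ x y, e (x * y) = e x + MonoidAlgebra.of ℤ Q (ρ x) • e y) →
      e 1 = 0 := by
    intro e he
    have := he 1 1
    rw [mul_one, map_one, map_one, one_smul] at this
    simpa using this
  have inv : ∀ e : F → M, (∀ x y, e (x * y) = e x + MonoidAlgebra.of ℤ Q (ρ x) • e y) →
      ∀ x, e x⁻¹ = -(MonoidAlgebra.of ℤ Q (ρ x⁻¹) • e x) := by
    intro e he x
    have h := he x⁻¹ x
    rw [inv_mul_cancel, one e he] at h
    exact eq_neg_of_add_eq_zero_left h.symm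
  funext a
  have ha : a ∈ Subgroup.closure (Set.range b) := by rw [basis_closure]; trivial
  induction ha using Subgroup.closure_induction with
  | mem x hx => obtain ⟨i, rfl⟩ := hx; exact h i
  | one => rw [one d hd, one d' hd']
  | mul x y _ _ hx hy => rw [hd, hd', hx, hy]
  | inv x _ hx => rw [inv d hd, inv d' hd', hx]

theorem fox_unique (b : FreeGroupBasis ι F) (ρ : F →* Q) (d : F → FreeMod ι Q)
    (hd : ∀ x y, d (x * y) = d x + MonoidAlgebra.of ℤ Q (ρ x) • d y)
    (h : ∀ i, d (b i) = Finsupp.single i 1) : d = fox b ρ :=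
  crossed_unique b ρ d _ hd (fox_mul b ρ) fun i => by rw [h, fox_basis]

/-- For a normal subgroup `K` of the free group that is contained in `ker ρ`, the image of `K`
under the Fox derivation is a `ℤ[Q]`-submodule. -/
def foxSubmodule (b : FreeGroupBasis ι F) (ρ : F →* Q) (hρ : Function.Surjective ρ)
    (K : Subgroup F) (hK : K.Normal) (hle : K ≤ ρ.ker) :
    Submodule (MonoidAlgebra ℤ Q) (FreeMod ι Q) where
  carrier := fox b ρ '' K
  zero_mem' := ⟨1, one_mem K, fox_one b ρ⟩
  add_mem' := by
    rintro _ _ ⟨x, hx, rfl⟩ ⟨y, hy, rfl⟩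
    refine ⟨x * y, mul_mem hx hy, ?_⟩
    rw [fox_mul, MonoidHom.mem_ker.1 (hle hx), map_one, one_smul]
  smul_mem' := by
    have add : ∀ v w, v ∈ fox b ρ '' K → w ∈ fox b ρ '' K → v + w ∈ fox b ρ '' K := by
      rintro _ _ ⟨x, hx, rfl⟩ ⟨y, hy, rfl⟩
      refine ⟨x * y, mul_mem hx hy, ?_⟩
      rw [fox_mul, MonoidHom.mem_ker.1 (hle hx), map_one, one_smul]
    have neg : ∀ v, v ∈ fox b ρ '' K → -v ∈ fox b ρ '' K := by
      rintro _ ⟨x, hx, rfl⟩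
      refine ⟨x⁻¹, inv_mem hx, ?_⟩
      rw [fox_inv, map_inv, MonoidHom.mem_ker.1 (hle hx), inv_one, map_one, one_smul]
    have zero : (0 : FreeMod ι Q) ∈ fox b ρ '' K := ⟨1, one_mem K, fox_one b ρ⟩
    have zsmul : ∀ (n : ℤ) v, v ∈ fox b ρ '' K → n • v ∈ fox b ρ '' K := fun n v hv =>
      zsmul_mem (K := (⟨⟨⟨fox b ρ '' K, fun {v w} => add v w⟩, zero⟩,
        fun {v} => neg v⟩ : AddSubgroup (FreeMod ι Q))) hv n
    intro r v hv
    induction r using MonoidAlgebra.induction_on with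
    | of q =>
      obtain ⟨x, hx, rfl⟩ := hv
      obtain ⟨t, rfl⟩ := hρ q
      refine ⟨t * x * t⁻¹, hK.conj_mem x hx t, ?_⟩
      have h1 : ρ x = 1 := MonoidHom.mem_ker.1 (hle hx)
      rw [fox_mul, fox_mul, fox_inv, smul_neg, ← mul_smul, ← map_mul, ← map_mul]
      have h2 : ρ (t * x * t⁻¹) = 1 := by simp [h1]
      rw [h2, map_one, one_smul]
      abel
    | add r s hr hs => rw [add_smul]; exact add _ _ hr hs
    | smul n r hr => rw [smul_assoc]; exact zsmul n _ hr

end Fox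

/-! ### The groups `T`, `H`, `F` -/

section Groups

variable (g : ℕ)

/-- The free group `T_{2g+1}`; its generators, numbered `1, …, 2g+1` in the text, are indexed
by `Fin (2g+1)` here. -/
abbrev T : Type := FreeGroup (Fin (2 * g + 1))

/-- The relators `y_i²`. -/
def rels : Set (T g) := Set.range fun i => FreeGroup.of i ^ 2

/-- `H_{2g+1} = ⟨y_1, …, y_{2g+1} ∣ y_1², …, y_{2g+1}²⟩`. -/
abbrev H : Type := PresentedGroup (rels g)

/-- The kernel `I_{2g+1}` of `T_{2g+1} → H_{2g+1}`. -/
abbrev I : Subgroup (T g) := Subgroup.normalClosure (rels g)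

/-- The generators of `H_{2g+1}`. -/
def y (i : Fin (2 * g + 1)) : H g := PresentedGroup.of i

theorem y_sq (i : Fin (2 * g + 1)) : y g i * y g i = 1 := by
  have h : PresentedGroup.mk (rels g) (FreeGroup.of i ^ 2) = 1 :=
    PresentedGroup.one_of_mem ⟨i, rfl⟩
  rw [map_pow, pow_two] at h
  exact h

theorem y_inv (i : Fin (2 * g + 1)) : (y g i)⁻¹ = y g i :=
  inv_eq_of_mul_eq_one_left (y_sq g i)

/-- `μ : H_{2g+1} → ⟨τ ∣ τ²⟩`, `y_i ↦ τ`. -/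
def mu : H g →* Multiplicative (ZMod 2) :=
  PresentedGroup.toGroup (f := fun _ => Multiplicative.ofAdd 1) (by
    rintro _ ⟨i, rfl⟩
    rw [map_pow, FreeGroup.lift_apply_of]
    decide)

theorem mu_y (i : Fin (2 * g + 1)) : mu g (y g i) = Multiplicative.ofAdd 1 :=
  PresentedGroup.toGroup.of _

/-- The subgroup `F_{2g} = ker μ` of `H_{2g+1}`; it is free on `x_1, …, x_{2g}`
(see `xBasis`). -/
abbrev F : Subgroup (H g) := (mu g).ker

/-- `x_i = y_i y_{i+1}`, as an element of `F_{2g}`. -/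
def x (i : Fin (2 * g)) : F g :=
  ⟨y g i.castSucc * y g i.succ, by
    rw [MonoidHom.mem_ker, map_mul, mu_y, mu_y]; decide⟩

/-- The homomorphism from the free group on `2g` letters to `H_{2g+1}` given by `x_i`. -/
def xHom : FreeGroup (Fin (2 * g)) →* H g := FreeGroup.lift fun i => (x g i : H g)

theorem y_zero_mul_mem (i : Fin (2 * g + 1)) : y g 0 * y g i ∈ (xHom g).range := by
  induction i using Fin.induction with
  | zero => rw [y_sq]; exact one_mem _
  | succ i hi =>
    have h : y g 0 * y g i.succ = (y g 0 * y g i.castSucc) * (y g i.castSucc * y g i.succ) := by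
      rw [mul_assoc, ← mul_assoc (y g i.castSucc), y_sq, one_mul]
    rw [h]
    exact mul_mem hi ⟨FreeGroup.of i, by simp [xHom, x]⟩

theorem xHom_range_le : (xHom g).range ≤ F g := by
  rintro _ ⟨w, rfl⟩
  induction w using FreeGroup.induction_on with
  | C1 => rw [map_one]; exact one_mem _
  | of i => simp only [xHom, FreeGroup.lift_apply_of]; exact (x g i).2
  | inv_of i hi => rw [map_inv]; exact inv_mem hi
  | mul a b ha hb => rw [map_mul]; exact mul_mem ha hb

theorem mem_or_mem (h : H g) : h ∈ (xHom g).range ∨ y g 0 * h ∈ (xHom g).range := by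
  obtain ⟨w, rfl⟩ := PresentedGroup.mk_surjective (rels g) h
  have step : ∀ (i : Fin (2 * g + 1)) (h : H g),
      (h ∈ (xHom g).range ∨ y g 0 * h ∈ (xHom g).range) →
      (y g i * h ∈ (xHom g).range ∨ y g 0 * (y g i * h) ∈ (xHom g).range) := by
    rintro i h (hh | hh)
    · right
      rw [← mul_assoc]
      exact mul_mem (y_zero_mul_mem g i) hh
    · left
      have e : y g i * h = (y g 0 * y g i)⁻¹ * (y g 0 * h) := by
        rw [mul_inv_rev, y_inv, y_inv, mul_assoc, ← mul_assoc (y g 0), y_sq, one_mul]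
      rw [e]
      exact mul_mem (inv_mem (y_zero_mul_mem g i)) hh
  suffices H : ∀ h : H g, (h ∈ (xHom g).range ∨ y g 0 * h ∈ (xHom g).range) →
      (PresentedGroup.mk (rels g) w * h ∈ (xHom g).range ∨
        y g 0 * (PresentedGroup.mk (rels g) w * h) ∈ (xHom g).range) by
    simpa using H 1 (Or.inl (one_mem _))
  induction w using FreeGroup.induction_on with
  | C1 => intro h hh; simpa using hh
  | of i => exact step i
  | inv_of i _ =>
    intro h hh
    have e : PresentedGroup.mk (rels g) (FreeGroup.of i)⁻¹ = y g i := by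
      rw [map_inv]; exact y_inv g i
    rw [e]
    exact step i h hh
  | mul a b ha hb =>
    intro h hh
    rw [map_mul, mul_assoc]
    exact ha _ (hb _ hh)

theorem xHom_range : (xHom g).range = F g := by
  refine le_antisymm (xHom_range_le g) fun h hh => ?_
  rcases mem_or_mem g h with h1 | h1
  · exact h1
  · exfalso
    have h2 := xHom_range_le g h1
    rw [MonoidHom.mem_ker] at h2 hh
    rw [map_mul, hh, mu_y, mul_one] at h2
    exact absurd h2 (by decide)

/-- `z_0 = 1`, and `z_1, …, z_{2g}` are the free generators. -/
def zElt (i : Fin (2 * g + 1)) : FreeGroup (Fin (2 * g)) :=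
  Fin.cases 1 (fun j => FreeGroup.of j) i

/-- The automorphism of the free group inverting every generator. -/
def invHom : FreeGroup (Fin (2 * g)) →* FreeGroup (Fin (2 * g)) :=
  FreeGroup.lift fun j => (FreeGroup.of j)⁻¹

theorem invHom_invHom (w : FreeGroup (Fin (2 * g))) : invHom g (invHom g w) = w := by
  have h : (invHom g).comp (invHom g) = MonoidHom.id _ := by
    ext j; simp [invHom]
  exact DFunLike.congr_fun h w

theorem invHom_zElt (i : Fin (2 * g + 1)) : invHom g (zElt g i) = (zElt g i)⁻¹ := by
  induction i using Fin.cases with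
  | zero => simp [zElt]
  | succ j => simp [zElt, invHom]

/-- The involution `w ↦ z_i⁻¹ w̄`, by which `y_{i+1}` acts. -/
def yPerm (i : Fin (2 * g + 1)) : Equiv.Perm (FreeGroup (Fin (2 * g))) where
  toFun w := (zElt g i)⁻¹ * invHom g w
  invFun w := (zElt g i)⁻¹ * invHom g w
  left_inv w := by simp [invHom_zElt, invHom_invHom]
  right_inv w := by simp [invHom_zElt, invHom_invHom]

/-- The action of `H_{2g+1}` on the free group that witnesses the freeness of `F_{2g}`. -/
def permHom : H g →* Equiv.Perm (FreeGroup (Fin (2 * g))) :=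
  PresentedGroup.toGroup (f := yPerm g) (by
    rintro _ ⟨i, rfl⟩
    rw [map_pow, FreeGroup.lift_apply_of, pow_two]
    ext1 w
    exact (yPerm g i).left_inv w)

theorem permHom_y (i : Fin (2 * g + 1)) : permHom g (y g i) = yPerm g i :=
  PresentedGroup.toGroup.of _

/-- `x_i ↦ z_{i-1}⁻¹ z_i`. -/
def alphaHom : FreeGroup (Fin (2 * g)) →* FreeGroup (Fin (2 * g)) :=
  FreeGroup.lift fun j => (zElt g j.castSucc)⁻¹ * zElt g j.succ

theorem permHom_xHom (w v : FreeGroup (Fin (2 * g))) :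
    permHom g (xHom g w) v = alphaHom g w * v := by
  induction w using FreeGroup.induction_on generalizing v with
  | C1 => simp
  | of j =>
    simp only [xHom, x, alphaHom, FreeGroup.lift_apply_of, map_mul, permHom_y,
      Equiv.Perm.mul_apply]
    simp [yPerm, invHom_zElt, invHom_invHom, mul_assoc]
  | inv_of j hj =>
    rw [map_inv, map_inv, map_inv, Equiv.Perm.inv_eq_iff_eq, hj, mul_inv_cancel_left]
  | mul a b ha hb => simp [ha, hb, mul_assoc]

/-- `x_1 ⋯ x_i`, defined recursively. -/
def xPrefix (i : Fin (2 * g + 1)) : FreeGroup (Fin (2 * g)) :=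
  Fin.induction 1 (fun j w => w * FreeGroup.of j) i

theorem alphaHom_injective : Function.Injective (alphaHom g) := by
  let β : FreeGroup (Fin (2 * g)) →* FreeGroup (Fin (2 * g)) :=
    FreeGroup.lift fun j => xPrefix g j.succ
  have hz : ∀ i, β (zElt g i) = xPrefix g i := by
    intro i
    induction i using Fin.cases with
    | zero => simp [zElt, xPrefix]
    | succ j => simp [zElt, β]
  have h : β.comp (alphaHom g) = MonoidHom.id _ := by
    ext j
    simp only [alphaHom, MonoidHom.comp_apply, FreeGroup.lift_apply_of, map_mul, map_inv, hz,
      MonoidHom.id_apply]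
    simp [xPrefix]
  exact Function.LeftInverse.injective (g := β) fun w => DFunLike.congr_fun h w

theorem xHom_injective : Function.Injective (xHom g) := by
  intro v w h
  apply alphaHom_injective g
  have hv := permHom_xHom g v 1
  rw [h, permHom_xHom] at hv
  simpa using hv.symm

/-- The free basis `x_1, …, x_{2g}` of `F_{2g}` (see `xBasis_apply`). -/
def xBasis : FreeGroupBasis (Fin (2 * g)) (F g) :=
  FreeGroupBasis.ofRepr
    (((xHom g).ofInjective (xHom_injective g)).trans
      (MulEquiv.subgroupCongr (xHom_range g))).symm

theorem xBasis_apply (i : Fin (2 * g)) : xBasis g i = x g i := by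
  apply Subtype.ext
  change xHom g (FreeGroup.of i) = _
  simp [xHom]

/-- The product `y_a y_{a+1} ⋯ y_b` in the numbering `y_1, …, y_{2g+1}`
(an empty product if `b < a`). -/
def yUp (a b : ℕ) : H g :=
  (((List.finRange (2 * g + 1)).filter fun k => a ≤ k.val + 1 ∧ k.val + 1 ≤ b).map (y g)).prod

/-- The product `y_b y_{b-1} ⋯ y_a` in the numbering `y_1, …, y_{2g+1}`
(an empty product if `b < a`). -/
def yDown (b a : ℕ) : H g :=
  (((List.finRange (2 * g + 1)).filter
    fun k => a ≤ k.val + 1 ∧ k.val + 1 ≤ b).reverse.map (y g)).prod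

/-- `Δ = y_1 y_2 ⋯ y_{2g+1}`. -/
def Delta : H g := yUp g 1 (2 * g + 1)

theorem mu_Delta : mu g (Delta g) = Multiplicative.ofAdd 1 := by
  have h : Delta g = ((List.finRange (2 * g + 1)).map (y g)).prod := by
    unfold Delta yUp
    rw [List.filter_eq_self.2]
    intro k _
    have := k.2
    simp only [decide_eq_true_eq]
    omega
  rw [h, map_list_prod, List.map_map]
  have h2 : (mu g) ∘ (y g) = fun _ => Multiplicative.ofAdd 1 := funext (mu_y g)
  rw [h2, List.map_const', List.prod_replicate, List.length_finRange, pow_succ, pow_mul]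
  have h3 : (Multiplicative.ofAdd (1 : ZMod 2)) ^ 2 = 1 := by decide
  rw [h3, one_pow, one_mul]

/-- `Δ²` as an element of `F_{2g}`. -/
def DeltaSq : F g :=
  ⟨Delta g ^ 2, by rw [MonoidHom.mem_ker, map_pow, mu_Delta]; decide⟩

/-- The mapping class group `𝓜_{g,1} = {φ ∈ Aut(F_{2g}) ∣ φ(Δ²) = Δ²}`. -/
def MCG : Subgroup (MulAut (F g)) := MulAction.stabilizer (MulAut (F g)) (DeltaSq g)

end Groups

/-! ### The quotients `G`, `G⁺` and the modules `L_N`, `L_N⁺` -/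

section Modules

variable {g : ℕ}

/-- The subgroup `N` of `F_{2g}` is `𝓜_{g,1}`-characteristic: `φ(N) = N` for all `φ ∈ 𝓜_{g,1}`. -/
class IsMCGCharacteristic (N : Subgroup (F g)) : Prop where
  map_eq : ∀ φ ∈ MCG g, N.map (φ : F g ≃* F g).toMonoidHom = N

variable (N : Subgroup (F g)) [N.Normal] [IsMCGCharacteristic N]

/-- The image `ι(N)` of `N` in `H_{2g+1}`. -/
abbrev iotaN (N : Subgroup (F g)) : Subgroup (H g) := N.map (F g).subtype

theorem conjDelta_mem : (MulAut.conjNormal (Delta g) : MulAut (F g)) ∈ MCG g := by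
  rw [MCG, MulAction.mem_stabilizer_iff]
  apply Subtype.ext
  rw [MulAut.smul_def, MulAut.conjNormal_apply]
  simp only [DeltaSq, pow_two]
  group

/-- `ι(N)` is normal in `H_{2g+1}`. -/
instance iotaN_normal : (iotaN N).Normal := by
  have h1 : ∀ f ∈ F g, ∀ n ∈ iotaN N, f * n * f⁻¹ ∈ iotaN N := by
    rintro f hf _ ⟨n, hn, rfl⟩
    exact ⟨⟨f, hf⟩ * n * ⟨f, hf⟩⁻¹, Subgroup.Normal.conj_mem inferInstance n hn _, rfl⟩
  have h2 : ∀ n ∈ iotaN N, Delta g * n * (Delta g)⁻¹ ∈ iotaN N := by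
    rintro _ ⟨n, hn, rfl⟩
    have h := IsMCGCharacteristic.map_eq (N := N) _ (conjDelta_mem (g := g))
    refine ⟨MulAut.conjNormal (Delta g) n, ?_, ?_⟩
    · have : MulAut.conjNormal (Delta g) n ∈
          N.map (MulAut.conjNormal (Delta g) : F g ≃* F g).toMonoidHom := ⟨n, hn, rfl⟩
      rwa [h] at this
    · exact MulAut.conjNormal_apply _ _
  refine ⟨fun n hn h => ?_⟩
  by_cases hh : h ∈ F g
  · exact h1 h hh n hn
  · have hf : h * (Delta g)⁻¹ ∈ F g := by
      have h3 : ∀ c : Multiplicative (ZMod 2), c ≠ 1 → c = Multiplicative.ofAdd 1 := by decide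
      rw [MonoidHom.mem_ker, map_mul, map_inv, mu_Delta, h3 _ hh, mul_inv_cancel]
    have e : h * n * h⁻¹ =
        (h * (Delta g)⁻¹) * (Delta g * n * (Delta g)⁻¹) * (h * (Delta g)⁻¹)⁻¹ := by group
    rw [e]
    exact h1 _ hf _ (h2 n hn)

/-- `G = F_{2g} / N`. -/
abbrev G (N : Subgroup (F g)) [N.Normal] : Type := F g ⧸ N

/-- `G⁺ = H_{2g+1} / ι(N)`. -/
abbrev GPlus : Type := H g ⧸ iotaN N

/-- The quotient map `F_{2g} → G`. -/
abbrev rho (N : Subgroup (F g)) [N.Normal] : F g →* G N := QuotientGroup.mk' N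

/-- The quotient map `H_{2g+1} → G⁺`. -/
abbrev rhoPlus : H g →* GPlus N := QuotientGroup.mk' (iotaN N)

/-- The map `G → G⁺` induced by the inclusion of `F_{2g}` in `H_{2g+1}`. -/
def iotaBar : G N →* GPlus N :=
  QuotientGroup.map N (iotaN N) (F g).subtype (Subgroup.le_comap_map _ _)

/-- The composite `T_{2g+1} → H_{2g+1} → G⁺`, whose kernel is `Ñ`, the preimage of `N`. -/
def rhoTilde : T g →* GPlus N := (rhoPlus N).comp (PresentedGroup.mk (rels g))

theorem rhoTilde_surjective : Function.Surjective (rhoTilde N) :=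
  (QuotientGroup.mk'_surjective _).comp (PresentedGroup.mk_surjective _)

theorem I_le_ker : I g ≤ (rhoTilde N).ker := by
  intro w hw
  have h : PresentedGroup.mk (rels g) w = 1 := PresentedGroup.mk_eq_one_iff.2 hw
  rw [MonoidHom.mem_ker, rhoTilde, MonoidHom.comp_apply, h, map_one]

/-- The Magnus module `L_N = ⨁ᵢ ℤ[G] eᵢ` of `N ◁ F_{2g}`. -/
abbrev L (N : Subgroup (F g)) [N.Normal] : Type := FreeMod (Fin (2 * g)) (G N)

/-- The Fox derivation `𝔡_N : F_{2g} → L_N`. -/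
def foxN (N : Subgroup (F g)) [N.Normal] : F g → L N := fox (xBasis g) (rho N)

/-- The Magnus module `L_Ñ = ⨁ᵢ ℤ[G⁺] eᵢ` of `Ñ ◁ T_{2g+1}`. -/
abbrev LTilde : Type := FreeMod (Fin (2 * g + 1)) (GPlus N)

/-- The Fox derivation `𝔡_Ñ : T_{2g+1} → L_Ñ`. -/
def foxTilde : T g → LTilde N := fox (FreeGroupBasis.ofFreeGroup _) (rhoTilde N)

/-- The `ℤ[G⁺]`-submodule `𝔡_Ñ(I_{2g+1})` of `L_Ñ`. -/
def foxI : Submodule (MonoidAlgebra ℤ (GPlus N)) (LTilde N) :=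
  foxSubmodule (FreeGroupBasis.ofFreeGroup _) (rhoTilde N) (rhoTilde_surjective N) (I g)
    Subgroup.normalClosure_normal (I_le_ker N)

/-- `L_N⁺ = L_Ñ / 𝔡_Ñ(I_{2g+1})`. -/
def LPlus : Type := LTilde N ⧸ foxI N

instance : AddCommGroup (LPlus N) := inferInstanceAs (AddCommGroup (LTilde N ⧸ foxI N))

instance : Module (MonoidAlgebra ℤ (GPlus N)) (LPlus N) :=
  inferInstanceAs (Module (MonoidAlgebra ℤ (GPlus N)) (LTilde N ⧸ foxI N))

/-- `ℤ[G] → ℤ[G⁺]`. -/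
def algMap : MonoidAlgebra ℤ (G N) →+* MonoidAlgebra ℤ (GPlus N) :=
  MonoidAlgebra.mapDomainRingHom ℤ (iotaBar N)

/-- `L_N⁺` as a `ℤ[G]`-module, by restriction of scalars along `ℤ[G] → ℤ[G⁺]`. -/
instance : Module (MonoidAlgebra ℤ (G N)) (LPlus N) := Module.compHom (LPlus N) (algMap N)

/-- The quotient map `L_Ñ → L_N⁺`. -/
def prPlus : LTilde N →ₗ[MonoidAlgebra ℤ (GPlus N)] LPlus N := (foxI N).mkQ

/-- The Fox derivation `𝔡_N⁺ : H_{2g+1} → L_N⁺` induced by `𝔡_Ñ`. -/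
def foxPlus : H g → LPlus N :=
  Quotient.lift (s := QuotientGroup.leftRel (I g)) (fun w => prPlus N (foxTilde N w)) (by
    intro a b hab
    rw [← Quotient.eq_iff_equiv, Quotient.eq, QuotientGroup.leftRel_apply] at hab
    have e : b = a * (a⁻¹ * b) := by group
    have h : prPlus N (foxTilde N (a⁻¹ * b)) = 0 :=
      (Submodule.Quotient.mk_eq_zero _).2 ⟨_, hab, rfl⟩
    change prPlus N (foxTilde N a) = prPlus N (foxTilde N b)
    rw [e, foxTilde, fox_mul, ← foxTilde, map_add, map_smul, h, smul_zero, add_zero])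

theorem foxPlus_mk (w : T g) :
    foxPlus N (PresentedGroup.mk (rels g) w) = prPlus N (foxTilde N w) := rfl

theorem foxPlus_mul (a b : H g) :
    foxPlus N (a * b) = foxPlus N a + MonoidAlgebra.of ℤ _ (rhoPlus N a) • foxPlus N b := by
  obtain ⟨a, rfl⟩ := PresentedGroup.mk_surjective _ a
  obtain ⟨b, rfl⟩ := PresentedGroup.mk_surjective _ b
  rw [← map_mul, foxPlus_mk, foxPlus_mk, foxPlus_mk, foxTilde, fox_mul, map_add, map_smul]
  rfl

/-- The `ℤ[G]`-homomorphism `ι̂ : L_N → L_N⁺`: the one with `ι̂ ∘ 𝔡_N = 𝔡_N⁺` on `F_{2g}`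
(see `iotaHat_foxN`), that is, `eᵢ ↦ 𝔡_N⁺(x_i)`. -/
def iotaHat : L N →ₗ[MonoidAlgebra ℤ (G N)] LPlus N :=
  Finsupp.linearCombination _ fun i => foxPlus N (x g i)

theorem iotaHat_foxN (a : F g) : iotaHat N (foxN N a) = foxPlus N a := by
  refine congrFun (crossed_unique (xBasis g) (rho N) (fun a => iotaHat N (foxN N a))
    (fun a : F g => foxPlus N a) ?_ ?_ ?_) a
  · intro a b
    simp only [foxN, fox_mul, map_add, map_smul]
  · intro a b
    rw [Subgroup.coe_mul, foxPlus_mul]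
    congr 1
    change _ = algMap N (MonoidAlgebra.of ℤ _ (rho N a)) • foxPlus N b
    simp [algMap, iotaBar]
  · intro i
    change iotaHat N (fox (xBasis g) (rho N) (xBasis g i)) = foxPlus N (xBasis g i)
    rw [fox_basis, xBasis_apply]
    simp [iotaHat]

/-- The elements `u_1, …, u_{2g}` of `L_N⁺`; `u_{k+1}` is the value at `k : Fin (2g)`:
`u_{2i} = y_1 ⋯ y_{2i-1} 𝔡_N⁺(y_{2i} ⋯ y_{2g+1})` and
`u_{2i-1} = - y_{2g+1} ⋯ y_{2i+1} 𝔡_N⁺(y_{2i} ⋯ y_1)`. -/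
def u (k : Fin (2 * g)) : LPlus N :=
  if Even (k.val + 1) then
    MonoidAlgebra.of ℤ _ (rhoPlus N (yUp g 1 k.val)) •
      foxPlus N (yUp g (k.val + 1) (2 * g + 1))
  else
    -(MonoidAlgebra.of ℤ _ (rhoPlus N (yDown g (2 * g + 1) (k.val + 3))) •
      foxPlus N (yDown g (k.val + 2) 1))

/-- `w_0 = 𝔡_N⁺(Δ)`. -/
def w₀ : LPlus N := foxPlus N (Delta g)

end Modules

end Magnus

end

/-!
Write `a_i = 𝔡_N⁺(y_i)` and `p_k = 𝔡_N⁺(y_1 ⋯ y_k)`.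

The module `L_N⁺` is generated over `ℤ[G⁺]` by the `a_i`, subject to `(1 + y_i) a_i = 0`. An odd
element `h` of `G⁺` therefore acts on `a_i` as the element `-h y_i` of `ℤ[G]`, so the `a_i` span
`L_N⁺` over `ℤ[G]`. They are independent: the `ℤ[G⁺]`-linear map `a_i ↦ (1 - y_i) e_i` is well
defined (`foxI_le_ker_oneSub`), and for `c` in `ℤ[G]` the elements `c` and `c y_i` are supported on
different cosets of `G` in `G⁺`. Hence `L_N⁺` is free of rank `2g+1` over `ℤ[G]` (`basisFoxY`).

As `G` is finite, `ℤ[G]` is Noetherian, and a spanning family with as many elements as a basis is a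
basis (`linearIndependent_of_top_le_span`). So it suffices to see that certain families span.

* `u_{k+1}` is `w_0 - p_k` for `k` odd and `Δ⁻¹ p_{k+2}` for `k` even. Since
  `p_{k+1} = p_k + y_1 ⋯ y_k a_{k+1}`, where either `y_1 ⋯ y_k` or `Δ⁻¹ y_1 ⋯ y_k` is in `G`, every
  `a_{k+1}` is obtained successively from the `u_k` and `w_0` (`top_le_span_uw`).
* `ι̂(e_k) = a_k - x_k a_{k+1}`, so these elements and `a_1` span `L_N⁺`
  (`top_le_span_iotaHatFamily`); in particular the `ι̂(e_k)` are independent and `ι̂` is injective.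
* `y_1 u_{k+1}` is the image under `ι̂` of `𝔡_N(q_{2g+1}) - 𝔡_N(q_k)` for `k` odd and of
  `y_1 Δ⁻¹ 𝔡_N(q_{k+2})` for `k` even, where `q_k` is the one of `y_1 ⋯ y_k` and `y_2 ⋯ y_k` that
  has even length. As `q_1 = 1`, the span of these preimages contains all `𝔡_N(q_k)`, and
  `q_{k+2} = q_k x_{k+1}` shows that it contains every `e_k` (`top_le_span_uLift`).
-/

noncomputable section

namespace Magnus

/-! ### Spanning families of the size of a basis -/

/-- Over a left Noetherian ring, a spanning family of the same finite size as a basis is linearly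
independent, since a surjective endomorphism of a Noetherian module is injective. -/
theorem linearIndependent_of_top_le_span {R M ι κ : Type*} [Ring R] [IsNoetherianRing R]
    [AddCommGroup M] [Module R M] [Finite κ] (b : Module.Basis κ R M) (e : ι ≃ κ) (v : ι → M)
    (hv : ⊤ ≤ Submodule.span R (Set.range v)) : LinearIndependent R v := by
  have : Module.Finite R M := Module.Finite.of_basis b
  let f : M →ₗ[R] M := b.constr ℕ fun k => v (e.symm k)
  have hf : ∀ i, f (b (e i)) = v i := fun i => by simp [f]
  have hs : Function.Surjective f := by
    rw [← LinearMap.range_eq_top, eq_top_iff]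
    refine hv.trans (Submodule.span_le.2 ?_)
    rintro _ ⟨i, rfl⟩
    exact ⟨_, hf i⟩
  have hi : Function.Injective f := IsNoetherian.injective_of_surjective_endomorphism f hs
  have h := (b.linearIndependent.comp e e.injective).map' f (LinearMap.ker_eq_bot.2 hi)
  exact (funext hf : _ = v) ▸ h

theorem isNoetherianRing_monoidAlgebra (K : Type*) [Group K] [Finite K] :
    IsNoetherianRing (MonoidAlgebra ℤ K) := by
  have : Module.Finite ℤ (MonoidAlgebra ℤ K) := inferInstance
  exact isNoetherian_of_tower ℤ inferInstance

/-! ### Products of consecutive generators -/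

section Words

variable (g : ℕ)

theorem filter_append_filter {α : Type*} [LinearOrder α] (p q : α → Prop) [DecidablePred p]
    [DecidablePred q] (l : List α) (hl : l.Pairwise (· < ·)) (hpq : ∀ a b, p a → q b → a < b) :
    l.filter p ++ l.filter q = l.filter fun a => p a ∨ q a := by
  induction l with
  | nil => rfl
  | cons a l ih =>
    rw [List.pairwise_cons] at hl
    by_cases hp : p a
    · have hq : ¬ q a := fun hq => lt_irrefl _ (hpq a a hp hq)
      simp [hp, hq, ih hl.2]
    · by_cases hq : q a
      · have hn : ∀ b ∈ l, ¬ p b := fun b hb hpb => lt_asymm (hpq b a hpb hq) (hl.1 b hb)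
        have h1 : l.filter p = [] := by simpa using hn
        have h2 := ih hl.2
        rw [h1, List.nil_append] at h2
        simp [hp, hq, h1, h2]
      · simp [hp, hq, ih hl.2]

theorem yUp_mul_yUp {a b c : ℕ} (hab : a ≤ b + 1) (hbc : b ≤ c) :
    yUp g a b * yUp g (b + 1) c = yUp g a c := by
  unfold yUp
  rw [← List.prod_append, ← List.map_append, filter_append_filter]
  · congr 3
    funext k
    simp only [decide_eq_decide]
    omega
  · exact List.pairwise_lt_finRange _
  · intro i j hi hj
    rw [Fin.lt_def]
    omega

theorem yUp_self (i : Fin (2 * g + 1)) : yUp g (i.val + 1) (i.val + 1) = y g i := by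
  unfold yUp
  have h : (List.finRange (2 * g + 1)).filter
      (fun k => i.val + 1 ≤ k.val + 1 ∧ k.val + 1 ≤ i.val + 1) = [i] := by
    have h1 : ∀ k : Fin (2 * g + 1),
        (i.val + 1 ≤ k.val + 1 ∧ k.val + 1 ≤ i.val + 1) ↔ k = i := by
      intro k
      rw [Fin.ext_iff]
      omega
    simp only [h1]
    have h2 := (List.nodup_finRange (2 * g + 1)).count (a := i)
    rw [if_pos (List.mem_finRange i)] at h2
    simpa [h2, beq_eq_decide] using List.filter_beq (l := List.finRange (2 * g + 1)) i
  rw [h]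
  simp

theorem yUp_empty {a b : ℕ} (h : b < a) : yUp g a b = 1 := by
  unfold yUp
  rw [List.filter_eq_nil_iff.2]
  · rfl
  · intro k _
    simp only [decide_eq_true_eq]
    omega

theorem yDown_eq_inv (a b : ℕ) : yDown g b a = (yUp g a b)⁻¹ := by
  unfold yDown yUp
  rw [List.prod_inv_reverse, List.map_reverse, List.map_map]
  congr 3
  funext k
  exact (y_inv g k).symm

/-- `y_1 ⋯ y_k`. -/
abbrev yPrefix (k : ℕ) : H g := yUp g 1 k

theorem yPrefix_zero : yPrefix g 0 = 1 := yUp_empty g one_pos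

theorem yPrefix_succ (i : Fin (2 * g + 1)) :
    yPrefix g (i.val + 1) = yPrefix g i.val * y g i := by
  rw [← yUp_self, yUp_mul_yUp g (by omega) (by omega)]

theorem yPrefix_add_two (k : Fin (2 * g)) :
    yPrefix g (k.val + 2) = yPrefix g k.val * x g k := by
  have h1 := yPrefix_succ g k.castSucc
  have h2 := yPrefix_succ g k.succ
  simp only [Fin.val_castSucc, Fin.val_succ] at h1 h2
  rw [h2, h1, mul_assoc]
  rfl

theorem yPrefix_one : yPrefix g 1 = y g 0 := by
  simpa [yPrefix_zero] using yPrefix_succ g 0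

theorem mu_yPrefix {k : ℕ} (hk : k ≤ 2 * g + 1) :
    mu g (yPrefix g k) = Multiplicative.ofAdd (k : ZMod 2) := by
  induction k with
  | zero => simp [yPrefix_zero]
  | succ k ih =>
    have h := yPrefix_succ g ⟨k, hk⟩
    simp only at h
    rw [h, map_mul, ih (by omega), mu_y, ← ofAdd_add]
    simp

theorem mu_yPrefix_of_even {k : ℕ} (hk : k ≤ 2 * g + 1) (h : Even k) :
    mu g (yPrefix g k) = 1 := by
  rw [mu_yPrefix g hk, (ZMod.natCast_eq_zero_iff_even).2 h, ofAdd_zero]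

theorem mu_yPrefix_of_odd {k : ℕ} (hk : k ≤ 2 * g + 1) (h : Odd k) :
    mu g (yPrefix g k) = Multiplicative.ofAdd 1 := by
  rw [mu_yPrefix g hk, (ZMod.natCast_eq_one_iff_odd).2 h]

theorem ofAdd_one_mul_self :
    (Multiplicative.ofAdd (1 : ZMod 2)) * Multiplicative.ofAdd 1 = 1 := by decide

theorem eq_ofAdd_one_of_ne_one : ∀ c : Multiplicative (ZMod 2), c ≠ 1 →
    c = Multiplicative.ofAdd 1 := by decide

end Words

/-! ### The group `G` inside `G⁺`, and restriction of scalars to `ℤ[G]` -/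

section Basics

variable {g : ℕ} (N : Subgroup (F g)) [N.Normal] [IsMCGCharacteristic N]

theorem iotaBar_injective : Function.Injective (iotaBar N) := by
  rw [injective_iff_map_eq_one]
  intro q hq
  obtain ⟨f, rfl⟩ := QuotientGroup.mk'_surjective N q
  have h : (f : H g) ∈ iotaN N := (QuotientGroup.eq_one_iff _).1 hq
  obtain ⟨n, hn, hnf⟩ := h
  have : n = f := Subtype.ext hnf
  exact (QuotientGroup.eq_one_iff _).2 (this ▸ hn)

/-- The map `G⁺ → ℤ/2` induced by `mu`; its kernel is `G`. -/
def muBar : GPlus N →* Multiplicative (ZMod 2) :=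
  QuotientGroup.lift (iotaN N) (mu g) (by
    rintro _ ⟨n, _, rfl⟩
    exact n.2)

theorem muBar_rhoPlus (h : H g) : muBar N (rhoPlus N h) = mu g h := rfl

theorem muBar_iotaBar (q : G N) : muBar N (iotaBar N q) = 1 := by
  obtain ⟨f, rfl⟩ := QuotientGroup.mk'_surjective N q
  exact f.2

/-- The additive action of `h ∈ H` on `L_N⁺`. -/
abbrev act (h : H g) (m : LPlus N) : LPlus N := MonoidAlgebra.of ℤ _ (rhoPlus N h) • m

theorem act_mul (h k : H g) (m : LPlus N) : act N (h * k) m = act N h (act N k m) := by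
  simp only [act, map_mul, mul_smul]

theorem act_one (m : LPlus N) : act N 1 m = m := by
  simp only [act, map_one, one_smul]

theorem of_rho_smul (f : F g) (m : LPlus N) :
    MonoidAlgebra.of ℤ (G N) (rho N f) • m = act N f m := by
  change algMap N (MonoidAlgebra.of ℤ _ (rho N f)) • m = _
  simp [algMap, iotaBar, act]

variable {N} in
/-- A `ℤ[G]`-submodule is stable under the even elements of `H`. -/
theorem act_mem {M : Submodule (MonoidAlgebra ℤ (G N)) (LPlus N)} {h : H g} (hh : mu g h = 1)
    {m : LPlus N} (hm : m ∈ M) : act N h m ∈ M := by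
  rw [show h = ((⟨h, hh⟩ : F g) : H g) from rfl, ← of_rho_smul]
  exact M.smul_mem _ hm

variable {N} in
theorem act_mem_iff {M : Submodule (MonoidAlgebra ℤ (G N)) (LPlus N)} {h : H g}
    (hh : mu g h = 1) {m : LPlus N} : act N h m ∈ M ↔ m ∈ M := by
  refine ⟨fun hm => ?_, act_mem hh⟩
  have := act_mem (h := h⁻¹) (by rw [map_inv, hh, inv_one]) hm
  rwa [← act_mul, inv_mul_cancel, act_one] at this

theorem foxPlus_mul' (a b : H g) : foxPlus N (a * b) = foxPlus N a + act N a (foxPlus N b) :=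
  foxPlus_mul N a b

theorem foxPlus_one : foxPlus N 1 = 0 := by
  have h := foxPlus_mul' N 1 1
  rw [mul_one, act_one] at h
  simpa using h

theorem foxPlus_inv (a : H g) : foxPlus N a⁻¹ = -act N a⁻¹ (foxPlus N a) := by
  have h := foxPlus_mul' N a⁻¹ a
  rw [inv_mul_cancel, foxPlus_one] at h
  exact eq_neg_of_add_eq_zero_left h.symm

/-- The elements `𝔡_N⁺(y_i)`. -/
abbrev foxY (i : Fin (2 * g + 1)) : LPlus N := foxPlus N (y g i)

theorem act_y_foxY (i : Fin (2 * g + 1)) : act N (y g i) (foxY N i) = -foxY N i := by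
  have h := foxPlus_mul' N (y g i) (y g i)
  rw [y_sq, foxPlus_one] at h
  exact eq_neg_of_add_eq_zero_right h.symm

variable {N} in
/-- Once a `ℤ[G]`-submodule contains `𝔡_N⁺(y_i)`, it contains its whole `G⁺`-orbit, because an odd
`h` satisfies `h 𝔡_N⁺(y_i) = -(h y_i) 𝔡_N⁺(y_i)` with `h y_i` even. -/
theorem act_foxY_mem {M : Submodule (MonoidAlgebra ℤ (G N)) (LPlus N)} {i : Fin (2 * g + 1)}
    (hi : foxY N i ∈ M) (h : H g) : act N h (foxY N i) ∈ M := by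
  by_cases hh : mu g h = 1
  · exact act_mem hh hi
  · have e : act N h (foxY N i) = act N (h * y g i) (-foxY N i) := by
      rw [act_mul, ← act_y_foxY, ← act_mul, ← act_mul, mul_assoc, y_sq,
        mul_one]
    rw [e]
    refine act_mem ?_ (M.neg_mem hi)
    rw [map_mul, mu_y, eq_ofAdd_one_of_ne_one _ hh, ofAdd_one_mul_self]

/-! ### The `ℤ[G]`-basis `𝔡_N⁺(y_i)` of `L_N⁺` -/

theorem foxPlus_y_eq (i : Fin (2 * g + 1)) :
    foxY N i = prPlus N (Finsupp.single i 1) := by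
  have h := fox_basis (FreeGroupBasis.ofFreeGroup (Fin (2 * g + 1))) (rhoTilde N) i
  rw [← h]
  rfl

theorem top_le_of_foxY_mem (M : Submodule (MonoidAlgebra ℤ (G N)) (LPlus N))
    (hM : ∀ i, foxY N i ∈ M) : ⊤ ≤ M := by
  rintro m -
  obtain ⟨v, rfl⟩ := (foxI N).mkQ_surjective m
  change prPlus N v ∈ M
  induction v using Finsupp.induction_linear with
  | zero => rw [map_zero]; exact M.zero_mem
  | add v w hv hw => rw [map_add]; exact M.add_mem hv hw
  | single i r =>
    have e : prPlus N (Finsupp.single i r) = r • foxY N i := by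
      rw [foxPlus_y_eq, ← map_smul, Finsupp.smul_single, smul_eq_mul, mul_one]
    rw [e]
    clear e
    induction r using MonoidAlgebra.induction_on with
    | of q =>
      obtain ⟨h, rfl⟩ := QuotientGroup.mk'_surjective _ q
      exact act_foxY_mem (hM i) h
    | add r s hr hs =>
      rw [add_smul]
      exact M.add_mem hr hs
    | smul n r hr =>
      rw [smul_assoc]
      exact zsmul_mem hr n

/-- The `ℤ[G⁺]`-linear map `L_Ñ → L_Ñ` with `e_i ↦ (1 - y_i) e_i`. It annihilates the relators
`(1 + y_i) e_i` of `L_N⁺`. -/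
def oneSub : LTilde N →ₗ[MonoidAlgebra ℤ (GPlus N)] LTilde N :=
  Finsupp.linearCombination _ fun i =>
    Finsupp.single i (1 - MonoidAlgebra.of ℤ _ (rhoPlus N (y g i)))

theorem oneSub_foxTilde_mul (a b : T g) : oneSub N (foxTilde N (a * b)) =
    oneSub N (foxTilde N a) +
      MonoidAlgebra.of ℤ _ (rhoTilde N a) • oneSub N (foxTilde N b) := by
  rw [foxTilde, fox_mul, map_add, map_smul]

theorem oneSub_foxTilde_rel (i : Fin (2 * g + 1)) :
    oneSub N (foxTilde N (FreeGroup.of i ^ 2)) = 0 := by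
  have h : foxTilde N (FreeGroup.of i) = Finsupp.single i 1 :=
    fox_basis (FreeGroupBasis.ofFreeGroup (Fin (2 * g + 1))) (rhoTilde N) i
  have hr : rhoTilde N (FreeGroup.of i) = rhoPlus N (y g i) := rfl
  have hy : MonoidAlgebra.of ℤ _ (rhoPlus N (y g i)) * MonoidAlgebra.of ℤ _ (rhoPlus N (y g i))
      = 1 := by
    rw [← map_mul, ← map_mul, y_sq, map_one, map_one]
  rw [pow_two, oneSub_foxTilde_mul, h, hr, oneSub, Finsupp.linearCombination_single, one_smul,
    Finsupp.smul_single, ← Finsupp.single_add, smul_eq_mul, mul_sub, hy, mul_one,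
    sub_add_sub_cancel, sub_self, Finsupp.single_zero]

theorem foxI_le_ker_oneSub : foxI N ≤ LinearMap.ker (oneSub N) := by
  rintro _ ⟨w, hw, rfl⟩
  rw [LinearMap.mem_ker]
  change oneSub N (foxTilde N w) = 0
  have hone : oneSub N (foxTilde N 1) = 0 := by rw [foxTilde, fox_one, map_zero]
  have hinv : ∀ a, oneSub N (foxTilde N a⁻¹) =
      -(MonoidAlgebra.of ℤ _ (rhoTilde N a⁻¹) • oneSub N (foxTilde N a)) := fun a => by
    rw [foxTilde, fox_inv, map_neg, map_smul]
  let K : Subgroup (T g) :=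
    { carrier := {a | rhoTilde N a = 1 ∧ oneSub N (foxTilde N a) = 0}
      one_mem' := ⟨map_one _, hone⟩
      mul_mem' := fun {a b} ha hb => ⟨by rw [map_mul, ha.1, hb.1, one_mul], by
        rw [oneSub_foxTilde_mul, ha.2, hb.2, smul_zero, add_zero]⟩
      inv_mem' := fun {a} ha => ⟨by rw [map_inv, ha.1, inv_one], by
        rw [hinv, ha.2, smul_zero, neg_zero]⟩ }
  have hK : K.Normal := ⟨fun a ha t => ⟨by rw [map_mul, map_mul, ha.1, mul_one, map_inv,
      mul_inv_cancel], by
    rw [oneSub_foxTilde_mul, oneSub_foxTilde_mul, ha.2, smul_zero, add_zero, hinv, smul_neg,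
      ← mul_smul, ← map_mul, ← map_mul]
    have e : rhoTilde N (t * a * t⁻¹) = 1 := by
      rw [map_mul, map_mul, ha.1, mul_one, map_inv, mul_inv_cancel]
    rw [e, map_one, one_smul, add_neg_cancel]⟩⟩
  have hle : I g ≤ K := by
    refine Subgroup.normalClosure_le_normal ?_
    rintro _ ⟨i, rfl⟩
    exact ⟨I_le_ker N (Subgroup.subset_normalClosure ⟨i, rfl⟩), oneSub_foxTilde_rel N i⟩
  exact (hle hw).2

theorem linearIndependent_foxY :
    LinearIndependent (MonoidAlgebra ℤ (G N)) (foxY N) := by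
  rw [Fintype.linearIndependent_iff]
  intro c hc i
  have h1 : prPlus N (∑ j, Finsupp.single j (algMap N (c j))) = 0 := by
    rw [map_sum, ← hc]
    refine Finset.sum_congr rfl fun j _ => ?_
    change _ = algMap N (c j) • foxY N j
    rw [foxPlus_y_eq, ← map_smul, Finsupp.smul_single, smul_eq_mul, mul_one]
  have h2 : oneSub N (∑ j, Finsupp.single j (algMap N (c j))) = 0 :=
    foxI_le_ker_oneSub N ((Submodule.Quotient.mk_eq_zero _).1 h1)
  have h3 : algMap N (c i) * (1 - MonoidAlgebra.of ℤ _ (rhoPlus N (y g i))) = 0 := by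
    have h4 := DFunLike.congr_fun h2 i
    simp only [map_sum, Finsupp.finsetSum_apply, oneSub, Finsupp.linearCombination_single,
      Finsupp.smul_single, Finsupp.single_apply, smul_eq_mul, Finset.sum_ite_eq',
      Finset.mem_univ, if_true, Finsupp.coe_zero, Pi.zero_apply] at h4
    exact h4
  ext q
  -- The coefficients of `c i` and of `(c i) y_i` are supported on the two cosets of `G` in `G⁺`.
  have h5 : (algMap N (c i)).coeff (iotaBar N q) = 0 := by
    rw [mul_sub, mul_one, sub_eq_zero] at h3
    rw [h3, MonoidAlgebra.of_apply, MonoidAlgebra.coeff_mul_single_eq_coeff_mul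
      (iotaBar N q * (rhoPlus N (y g i))⁻¹) fun _ _ => eq_mul_inv_iff_mul_eq.symm, mul_one]
    refine Finsupp.mapDomain_of_notMem_range _ _ ?_
    rintro ⟨r, hr⟩
    have h8 := congrArg (muBar N) hr
    rw [map_mul, map_inv, muBar_iotaBar, muBar_iotaBar, muBar_rhoPlus, mu_y, one_mul] at h8
    exact absurd h8 (by decide)
  exact (Finsupp.mapDomain_apply (iotaBar_injective N) (c i).coeff q).symm.trans h5

/-- The `ℤ[G]`-basis `𝔡_N⁺(y_1), …, 𝔡_N⁺(y_{2g+1})` of `L_N⁺`. -/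
def basisFoxY : Module.Basis (Fin (2 * g + 1)) (MonoidAlgebra ℤ (G N)) (LPlus N) :=
  Module.Basis.mk (linearIndependent_foxY N)
    (top_le_of_foxY_mem N _ fun i => Submodule.subset_span ⟨i, rfl⟩)

end Basics

section Families

variable {g : ℕ} (N : Subgroup (F g)) [N.Normal] [IsMCGCharacteristic N]

/-! ### The elements `u_k` in terms of `𝔡_N⁺(y_1 ⋯ y_k)` -/

theorem foxPlus_yPrefix_succ (i : Fin (2 * g + 1)) :
    foxPlus N (yPrefix g (i.val + 1)) =
      foxPlus N (yPrefix g i.val) + act N (yPrefix g i.val) (foxY N i) := by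
  rw [yPrefix_succ, foxPlus_mul']

/-- For `k` odd, `u_{k+1} = 𝔡_N⁺(Δ) - 𝔡_N⁺(y_1 ⋯ y_k)`. -/
theorem u_of_odd (k : Fin (2 * g)) (hk : Odd k.val) :
    u N k = w₀ N - foxPlus N (yPrefix g k.val) := by
  have h : Delta g = yPrefix g k.val * yUp g (k.val + 1) (2 * g + 1) :=
    (yUp_mul_yUp g (by omega) (by omega)).symm
  rw [u, if_pos hk.add_one, w₀, h, foxPlus_mul', add_sub_cancel_left]

/-- For `k` even, `u_{k+1} = Δ⁻¹ 𝔡_N⁺(y_1 ⋯ y_{k+2})`. -/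
theorem u_of_even (k : Fin (2 * g)) (hk : Even k.val) :
    u N k = act N (Delta g)⁻¹ (foxPlus N (yPrefix g (k.val + 2))) := by
  have h : Delta g = yPrefix g (k.val + 2) * yUp g (k.val + 3) (2 * g + 1) :=
    (yUp_mul_yUp g (by omega) (by omega)).symm
  have h1 : ¬ Even (k.val + 1) := Nat.not_even_iff_odd.2 hk.add_one
  rw [u, if_neg h1, yDown_eq_inv, yDown_eq_inv, foxPlus_inv, smul_neg, neg_neg, h, mul_inv_rev,
    act_mul]

theorem mu_Delta_inv_mul {k : ℕ} (hk : k ≤ 2 * g + 1) (h : Odd k) :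
    mu g ((Delta g)⁻¹ * yPrefix g k) = 1 := by
  rw [map_mul, map_inv, mu_Delta, mu_yPrefix_of_odd g hk h, inv_mul_cancel]

variable {N} in
/-- A `ℤ[G]`-submodule containing `𝔡_N⁺(y_1), …, 𝔡_N⁺(y_k)` contains the `G⁺`-orbit of
`𝔡_N⁺(y_1 ⋯ y_k)`. -/
theorem act_foxPlus_yPrefix_mem {M : Submodule (MonoidAlgebra ℤ (G N)) (LPlus N)} {k : ℕ}
    (hk : k ≤ 2 * g + 1) (hM : ∀ i : Fin (2 * g + 1), i.val < k → foxY N i ∈ M) (h : H g) :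
    act N h (foxPlus N (yPrefix g k)) ∈ M := by
  induction k with
  | zero => rw [yPrefix_zero, foxPlus_one, act, smul_zero]; exact M.zero_mem
  | succ k ih =>
    have e := foxPlus_yPrefix_succ N ⟨k, hk⟩
    simp only at e
    rw [e, act, smul_add]
    refine M.add_mem (ih (by omega) fun i hi => hM i (by omega)) ?_
    change act N h _ ∈ M
    rw [← act_mul]
    exact act_foxY_mem (hM ⟨k, hk⟩ (Nat.lt_succ_self k)) _

/-- The family `u_1, …, u_{2g}, w_0`. -/
def uw : Fin (2 * g) ⊕ Unit → LPlus N := Sum.elim (u N) fun _ => w₀ N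

/-- The family `u_1, …, u_{2g}, w_0` is triangular with unit diagonal with respect to
`𝔡_N⁺(y_1), …, 𝔡_N⁺(y_{2g+1})`. -/
theorem top_le_span_uw :
    ⊤ ≤ Submodule.span (MonoidAlgebra ℤ (G N)) (Set.range (uw N)) := by
  set M := Submodule.span (MonoidAlgebra ℤ (G N)) (Set.range (uw N))
  have hu : ∀ k, u N k ∈ M := fun k => Submodule.subset_span ⟨Sum.inl k, rfl⟩
  have hw : w₀ N ∈ M := Submodule.subset_span ⟨Sum.inr (), rfl⟩
  refine top_le_of_foxY_mem N M ?_
  suffices h : ∀ k (hk : k < 2 * g + 1), foxY N ⟨k, hk⟩ ∈ M from fun i => h i.1 i.2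
  intro k
  induction k using Nat.strong_induction_on with
  | _ k ih =>
    intro hk
    have hM := act_foxPlus_yPrefix_mem (M := M) hk.le fun i hi => ih i.1 hi i.2
    have e := foxPlus_yPrefix_succ N ⟨k, hk⟩
    simp only at e
    rcases Nat.even_or_odd k with hk2 | hk2
    · have h1 : foxPlus N (yPrefix g (k + 1)) ∈ M := by
        by_cases h : k + 1 < 2 * g
        · have h2 := M.sub_mem hw (hu ⟨k + 1, h⟩)
          rwa [u_of_odd N ⟨k + 1, h⟩ hk2.add_one, sub_sub_cancel] at h2
        · obtain ⟨m, hm⟩ := hk2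
          have h2 : k + 1 = 2 * g + 1 := by omega
          rw [h2]
          exact hw
      have h2 := hM 1
      rw [act_one] at h2
      rw [e, M.add_mem_iff_right h2] at h1
      exact (act_mem_iff (mu_yPrefix_of_even g hk.le hk2)).1 h1
    · have hk0 := hk2.pos
      have h1 : act N (Delta g)⁻¹ (foxPlus N (yPrefix g (k + 1))) ∈ M := by
        have h2 := hu ⟨k - 1, by omega⟩
        rw [u_of_even N ⟨k - 1, by omega⟩ (Nat.Odd.sub_odd hk2 odd_one)] at h2
        rwa [show k + 1 = k - 1 + 2 by omega]
      rw [e, act, smul_add, M.add_mem_iff_right (hM _)] at h1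
      rw [← act_mem_iff (mu_Delta_inv_mul hk.le hk2), act_mul]
      exact h1

/-! ### The image of `ι̂` -/

theorem iotaHat_single (k : Fin (2 * g)) :
    iotaHat N (Finsupp.single k 1) = foxY N k.castSucc - act N (x g k) (foxY N k.succ) := by
  have h : act N (x g k) (foxY N k.succ) = act N (y g k.castSucc) (-foxY N k.succ) := by
    rw [← act_y_foxY, ← act_mul]
    rfl
  rw [h, act, smul_neg, sub_neg_eq_add, iotaHat, Finsupp.linearCombination_single, one_smul]
  exact foxPlus_mul' N _ _

/-- The family consisting of the images `ι̂(e_k) = 𝔡_N⁺(y_k) - x_k 𝔡_N⁺(y_{k+1})` and of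
`𝔡_N⁺(y_1)`. -/
def iotaHatFamily : Fin (2 * g) ⊕ Unit → LPlus N :=
  Sum.elim (fun k => iotaHat N (Finsupp.single k 1)) fun _ => foxY N 0

theorem top_le_span_iotaHatFamily :
    ⊤ ≤ Submodule.span (MonoidAlgebra ℤ (G N)) (Set.range (iotaHatFamily N)) := by
  refine top_le_of_foxY_mem N _ fun i => ?_
  induction i using Fin.induction with
  | zero => exact Submodule.subset_span ⟨Sum.inr (), rfl⟩
  | succ k ih =>
    have h : iotaHat N (Finsupp.single k 1) ∈
        Submodule.span (MonoidAlgebra ℤ (G N)) (Set.range (iotaHatFamily N)) :=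
      Submodule.subset_span ⟨Sum.inl k, rfl⟩
    rw [iotaHat_single, Submodule.sub_mem_iff_right _ ih] at h
    exact (act_mem_iff (x g k).2).1 h

/-- A bijection between the index sets of the families of `2g + 1` elements. -/
def indexEquiv (g : ℕ) : Fin (2 * g) ⊕ Unit ≃ Fin (2 * g + 1) :=
  (Equiv.sumCongr (Equiv.refl _) (Equiv.equivPUnit (Fin 1)).symm).trans finSumFinEquiv

theorem linearIndependent_uw [Finite (G N)] :
    LinearIndependent (MonoidAlgebra ℤ (G N)) (uw N) :=
  have := isNoetherianRing_monoidAlgebra (G N)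
  linearIndependent_of_top_le_span (basisFoxY N) (indexEquiv g) _ (top_le_span_uw N)

theorem iotaHat_injective [Finite (G N)] : Function.Injective (iotaHat N) := by
  have := isNoetherianRing_monoidAlgebra (G N)
  have h := (linearIndependent_of_top_le_span (basisFoxY N) (indexEquiv g) _
    (top_le_span_iotaHatFamily N)).comp Sum.inl Sum.inl_injective
  have e : iotaHat N =
      Finsupp.linearCombination (MonoidAlgebra ℤ (G N)) (iotaHatFamily N ∘ Sum.inl) := by
    ext k
    simp [iotaHatFamily]
  rw [e]
  exact h

/-! ### The basis `y_1 u_1, …, y_1 u_{2g}` of `L_N` -/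

/-- The one of the words `y_1 ⋯ y_k` and `y_2 ⋯ y_k` that has even length. The latter is written
as `y_1 (y_1 ⋯ y_k)`, which is the same element of `H`. -/
def evenPrefix (g k : ℕ) : H g := if Even k then yPrefix g k else y g 0 * yPrefix g k

theorem evenPrefix_mem {k : ℕ} (hk : k ≤ 2 * g + 1) : evenPrefix g k ∈ F g := by
  rw [MonoidHom.mem_ker, evenPrefix]
  split_ifs with h
  · exact mu_yPrefix_of_even g hk h
  · rw [map_mul, mu_y, mu_yPrefix_of_odd g hk (Nat.not_even_iff_odd.1 h), ofAdd_one_mul_self]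

/-- `evenPrefix` as an element of `F`. -/
def evenPrefixF (k : Fin (2 * g + 2)) : F g :=
  ⟨evenPrefix g k.val, evenPrefix_mem (by omega)⟩

theorem evenPrefixF_add_two (k : Fin (2 * g)) :
    evenPrefixF (k.succ.succ) = evenPrefixF k.castSucc.castSucc * x g k := by
  apply Subtype.ext
  simp only [evenPrefixF, evenPrefix, Subgroup.coe_mul, Fin.val_succ, Fin.val_castSucc]
  have h : Even (k.val + 1 + 1) ↔ Even k.val := by simp [Nat.even_add_one]
  have e := yPrefix_add_two g k
  by_cases hk : Even k.val
  · rw [if_pos (h.2 hk), if_pos hk]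
    exact e
  · rw [if_neg (h.not.2 hk), if_neg hk, mul_assoc, ← e]

/-- `y_1 Δ⁻¹` as an element of `F`. -/
def yDeltaInv (g : ℕ) : F g :=
  ⟨y g 0 * (Delta g)⁻¹, by
    rw [MonoidHom.mem_ker, map_mul, map_inv, mu_Delta, mu_y, mul_inv_cancel]⟩

/-- The preimage of `y_1 u_{k+1}` under `ι̂`. -/
def uLift (k : Fin (2 * g)) : L N :=
  if Even k.val then MonoidAlgebra.of ℤ (G N) (rho N (yDeltaInv g)) •
      foxN N (evenPrefixF k.succ.succ)
  else foxN N (evenPrefixF (Fin.last _)) - foxN N (evenPrefixF k.castSucc.castSucc)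

theorem iotaHat_uLift (k : Fin (2 * g)) : iotaHat N (uLift N k) = act N (y g 0) (u N k) := by
  unfold uLift
  split_ifs with hk
  · have h : Even (k.val + 1 + 1) := by simpa [Nat.even_add_one] using hk
    rw [map_smul, iotaHat_foxN, of_rho_smul, u_of_even N k hk, ← act_mul]
    simp only [evenPrefixF, evenPrefix, Fin.val_succ, if_pos h]
    rfl
  · have hk' := Nat.not_even_iff_odd.1 hk
    have h : ¬ Even (2 * g + 1) := by simp
    rw [map_sub, iotaHat_foxN, iotaHat_foxN, u_of_odd N k hk', act, smul_sub]
    simp only [evenPrefixF, evenPrefix, Fin.val_last, Fin.val_castSucc, if_neg h, if_neg hk]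
    rw [foxPlus_mul', foxPlus_mul', add_sub_add_left_eq_sub]
    rfl

/-- The words `evenPrefix` satisfy `q_{k+2} = q_k x_{k+1}` with `q_0 = q_1 = 1`, so that a
`ℤ[G]`-submodule of `L_N` containing all their Fox derivatives contains every `e_k`. -/
theorem top_le_span_uLift :
    ⊤ ≤ Submodule.span (MonoidAlgebra ℤ (G N)) (Set.range (uLift N)) := by
  set M := Submodule.span (MonoidAlgebra ℤ (G N)) (Set.range (uLift N))
  have hu : ∀ k, uLift N k ∈ M := fun k => Submodule.subset_span ⟨k, rfl⟩
  have hone : foxN N (1 : F g) = 0 := fox_one _ _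
  have h0 : ∀ k : Fin (2 * g + 2), k.val = 0 → foxN N (evenPrefixF k) ∈ M := by
    intro k hk
    have e : evenPrefixF k = 1 := Subtype.ext (by simp [evenPrefixF, evenPrefix, hk, yPrefix_zero])
    rw [e, hone]
    exact M.zero_mem
  have h1 : ∀ k : Fin (2 * g + 2), k.val = 1 → foxN N (evenPrefixF k) ∈ M := by
    intro k hk
    have e : evenPrefixF k = 1 :=
      Subtype.ext (by simp [evenPrefixF, evenPrefix, hk, yPrefix_one, y_sq])
    rw [e, hone]
    exact M.zero_mem
  have hunit : ∀ (f : F g) (m : L N), MonoidAlgebra.of ℤ (G N) (rho N f) • m ∈ M → m ∈ M := by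
    intro f m hm
    have h := M.smul_mem (MonoidAlgebra.of ℤ (G N) (rho N f⁻¹)) hm
    rwa [← mul_smul, ← map_mul, ← map_mul, inv_mul_cancel, map_one, map_one, one_smul] at h
  have hlast : foxN N (evenPrefixF (Fin.last (2 * g + 1))) ∈ M := by
    rcases Nat.eq_zero_or_pos g with rfl | hg
    · exact h1 _ rfl
    · have h := hu ⟨1, by omega⟩
      rw [uLift, if_neg (by simp)] at h
      rwa [M.sub_mem_iff_left (h1 _ rfl)] at h
  have hall : ∀ k : Fin (2 * g + 2), foxN N (evenPrefixF k) ∈ M := by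
    intro k
    by_cases hk : Even k.val
    · by_cases hk0 : k.val = 0
      · exact h0 k hk0
      · obtain ⟨m, hm⟩ := hk
        have hlt : k.val - 2 < 2 * g := by omega
        have h := hu ⟨k.val - 2, hlt⟩
        rw [uLift, if_pos (by rw [Nat.even_iff]; simp only; omega)] at h
        have e : k = (⟨k.val - 2, hlt⟩ : Fin (2 * g)).succ.succ := by
          ext
          simp only [Fin.val_succ]
          omega
        rw [e]
        exact hunit _ _ h
    · by_cases hk0 : k = Fin.last _
      · rw [hk0]
        exact hlast
      · have hlt : k.val < 2 * g := by
          have h2 : k.val ≠ 2 * g + 1 := fun h => hk0 (Fin.ext h)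
          have h3 : k.val ≠ 2 * g := fun h => hk (by rw [h]; exact even_two_mul g)
          omega
        have h := hu ⟨k.val, hlt⟩
        rw [uLift, if_neg hk] at h
        rwa [M.sub_mem_iff_right hlast] at h
  have he : ∀ k : Fin (2 * g), Finsupp.single k 1 ∈ M := by
    intro k
    have h := hall k.succ.succ
    rw [evenPrefixF_add_two, foxN, fox_mul, ← foxN, M.add_mem_iff_right (hall _),
      ← xBasis_apply] at h
    have h2 := hunit _ _ h
    rwa [foxN, fox_basis] at h2
  rw [← (Finsupp.basisSingleOne (R := MonoidAlgebra ℤ (G N)) (ι := Fin (2 * g))).span_eq,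
    Submodule.span_le]
  rintro _ ⟨k, rfl⟩
  simpa using he k

theorem linearIndependent_uLift [Finite (G N)] :
    LinearIndependent (MonoidAlgebra ℤ (G N)) (uLift N) :=
  have := isNoetherianRing_monoidAlgebra (G N)
  linearIndependent_of_top_le_span Finsupp.basisSingleOne (Equiv.refl _) _ (top_le_span_uLift N)

end Families
end Magnus
end

theorem mainTheorem4 (g : ℕ) (hg : 1 ≤ g) (N : Subgroup (Magnus.F g)) [N.Normal]
    [Magnus.IsMCGCharacteristic N] [Finite (Magnus.G N)] :
    (∃ b : Module.Basis (Fin (2 * g) ⊕ Unit) (MonoidAlgebra ℤ (Magnus.G N)) (Magnus.LPlus N),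
      (∀ i, b (Sum.inl i) = Magnus.u N i) ∧ b (Sum.inr ()) = Magnus.w₀ N) ∧
    Function.Injective (Magnus.iotaHat N) ∧
    ∃ b : Module.Basis (Fin (2 * g)) (MonoidAlgebra ℤ (Magnus.G N)) (Magnus.L N),
      ∀ i, Magnus.iotaHat N (b i) =
        MonoidAlgebra.of ℤ (Magnus.GPlus N) (Magnus.rhoPlus N (Magnus.y g 0)) • Magnus.u N i := by
  refine ⟨⟨Module.Basis.mk (Magnus.linearIndependent_uw N) (Magnus.top_le_span_uw N),
    fun i => ?_, ?_⟩, Magnus.iotaHat_injective N,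
    Module.Basis.mk (Magnus.linearIndependent_uLift N) (Magnus.top_le_span_uLift N), fun i => ?_⟩
  · rw [Module.Basis.mk_apply, Magnus.uw, Sum.elim_inl]
  · rw [Module.Basis.mk_apply, Magnus.uw, Sum.elim_inr]
  · rw [Module.Basis.mk_apply, Magnus.iotaHat_uLift]
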